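/- Let $D=\{z\in\mathbb C:|z|<1\}$ and let $L^2_a(D)$ be the Bergman space of square integrable holomorphic functions on $D$, a closed subspace of $L^2(D)$ with respect to the area measure normalized so that $D$ has measure $1$. For a bounded function $f\in L^\infty(D)$ let $T_f:L^2_a(D)\to L^2_a(D)$ be the Toeplitz operator $T_f(g)=P(fg)$, where $P$ is the orthogonal projection of $L^2(D)$ onto $L^2_a(D)$. Let $h\in\mathbb C[z]$ be a polynomial which is not of the form $h_1(z^l)$ for any polynomial $h_1\in\mathbb C[z]$ and any integer $l>1$, and let $m\ge 1$ be an integer. Let $S:L^2_a(D)\to L^2_a(D)$ be a bounded linear operator which commutes with $T_{h(z^m)}$. Then $S$ commutes with $T_{z^m}$. In particular, if in addition $S$ is compact, then $S=0$. -/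

import Mathlib

open MeasureTheory Metric Polynomial
open scoped ENNReal

noncomputable section

/-- The area measure on the open unit disk of `ℂ`, normalized so that the disk has measure `1`. -/
def diskMeasure : Measure ℂ :=
  (volume (ball (0 : ℂ) 1))⁻¹ • volume.restrict (ball (0 : ℂ) 1)

/-- The Bergman space of the disk: the square integrable functions on the disk that are
(almost everywhere equal to) a holomorphic function on the disk, as a subspace of `L²`. -/
def bergmanSpace : Submodule ℂ (Lp ℂ 2 diskMeasure) where
  carrier := {f | ∃ F : ℂ → ℂ, DifferentiableOn ℂ F (ball 0 1) ∧ f =ᵐ[diskMeasure] F}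
  add_mem' := by
    rintro f g ⟨F, hF, hfF⟩ ⟨G, hG, hgG⟩
    exact ⟨F + G, hF.add hG, (Lp.coeFn_add f g).trans (hfF.add hgG)⟩
  zero_mem' := ⟨0, differentiableOn_const 0, Lp.coeFn_zero _ _ _⟩
  smul_mem' := by
    rintro c f ⟨F, hF, hfF⟩
    exact ⟨c • F, hF.const_smul c, (Lp.coeFn_smul c f).trans (hfF.const_smul c)⟩

/-- Sub-mean-value inequality on circles. -/
theorem two_pi_mul_enorm_le_lintegral_circle {F : ℂ → ℂ} {z : ℂ} {ρ r : ℝ}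
    (hF : DifferentiableOn ℂ F (ball z r)) (hρ : 0 < ρ) (hρr : ρ < r) :
    ENNReal.ofReal (2 * Real.pi) * ‖F z‖ₑ ≤
      ∫⁻ θ in Set.Ioo (-Real.pi) Real.pi, ‖F (circleMap z ρ θ)‖ₑ := by
  have hsub : closedBall z |ρ| ⊆ ball z r := by
    rw [abs_of_pos hρ]; exact closedBall_subset_ball hρr
  have h1 : Real.circleAverage F z ρ = F z := by
    apply DiffContOnCl.circleAverage
    apply DifferentiableOn.diffContOnCl
    exact hF.mono ((closure_ball_subset_closedBall).trans hsub)
  rw [Real.circleAverage_eq_integral_add (-Real.pi)] at h1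
  have h2 : ∫ θ in (-Real.pi)..Real.pi, F (circleMap z ρ θ) = (2 * Real.pi : ℝ) • F z := by
    rw [← h1, smul_smul, mul_inv_cancel₀ (by positivity), one_smul,
      intervalIntegral.integral_comp_add_right (fun θ => F (circleMap z ρ θ))]
    congr 1 <;> ring
  have h3 : ENNReal.ofReal (2 * Real.pi) * ‖F z‖ₑ
      = ‖∫ θ in (-Real.pi)..Real.pi, F (circleMap z ρ θ)‖ₑ := by
    rw [h2, enorm_smul, Real.enorm_eq_ofReal (by positivity)]
  rw [h3, intervalIntegral.integral_of_le (by linarith [Real.pi_pos]),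
    MeasureTheory.integral_Ioc_eq_integral_Ioo]
  exact enorm_integral_le_lintegral_enorm _

/-- Sub-mean-value inequality on disks. -/
theorem volume_ball_mul_enorm_le_lintegral {F : ℂ → ℂ} {z : ℂ} {r : ℝ}
    (hF : DifferentiableOn ℂ F (ball z r)) :
    volume (ball z r) * ‖F z‖ₑ ≤ ∫⁻ w in ball z r, ‖F w‖ₑ := by
  classical
  set g : ℂ → ℝ≥0∞ := (ball (0 : ℂ) r).indicator (fun w => ‖F (z + w)‖ₑ) with hg
  have hgm : Measurable g := by
    have hc : ContinuousOn (fun w => ‖F (z + w)‖ₑ) (ball (0 : ℂ) r) := by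
      apply continuous_enorm.comp_continuousOn
      refine hF.continuousOn.comp (by fun_prop) ?_
      intro w hw
      simpa using hw
    rw [hg, ← Set.piecewise_eq_indicator]
    exact hc.measurable_piecewise continuousOn_const measurableSet_ball
  have e1 : ∫⁻ w in ball z r, ‖F w‖ₑ = ∫⁻ w, g w := by
    rw [← lintegral_indicator measurableSet_ball,
      ← lintegral_add_left_eq_self _ z]
    congr 1; ext w
    simp [hg, Set.indicator]
  have key : ∀ (k : ℂ → ℝ≥0∞), Measurable k →
      ∫⁻ w, k w = ∫⁻ ρ in Set.Ioi (0 : ℝ), ∫⁻ θ in Set.Ioo (-Real.pi) Real.pi,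
        ENNReal.ofReal ρ * k (circleMap 0 ρ θ) := by
    intro k hk
    rw [← Complex.lintegral_comp_polarCoord_symm, polarCoord_target,
      Measure.volume_eq_prod, ← Measure.prod_restrict, lintegral_prod]
    · simp [circleMap, Complex.polarCoord_symm_apply, Complex.exp_mul_I]
    · apply Measurable.aemeasurable
      have : Measurable (fun p : ℝ × ℝ => Complex.polarCoord.symm p) := by
        simp only [Complex.polarCoord_symm_apply]
        fun_prop
      simp only [smul_eq_mul]
      exact (by fun_prop : Measurable fun p : ℝ × ℝ => ENNReal.ofReal p.1).mul (hk.comp this)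
  have e2 : volume (ball z r) * ‖F z‖ₑ
      = ∫⁻ w, (ball (0 : ℂ) r).indicator (fun _ => ‖F z‖ₑ) w := by
    rw [lintegral_indicator measurableSet_ball, setLIntegral_const, mul_comm]
    congr 1
    rw [Complex.volume_ball, Complex.volume_ball]
  rw [e1, e2, key _ (measurable_const.indicator measurableSet_ball), key _ hgm]
  apply setLIntegral_mono' measurableSet_Ioi
  intro ρ hρ
  have hρ0 : 0 < ρ := hρ
  have hmem : ∀ θ, circleMap 0 ρ θ ∈ ball (0 : ℂ) r ↔ ρ < r := by
    intro θ
    simp [abs_of_pos hρ0]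
  by_cases hρr : ρ < r
  · have := two_pi_mul_enorm_le_lintegral_circle hF hρ0 hρr
    have e3 : ∀ θ, g (circleMap 0 ρ θ) = ‖F (circleMap z ρ θ)‖ₑ := by
      intro θ
      rw [hg, Set.indicator_of_mem ((hmem θ).2 hρr)]
      simp [circleMap]
    simp only [e3]
    rw [lintegral_const_mul' _ _ ENNReal.ofReal_ne_top,
      lintegral_const_mul' _ _ ENNReal.ofReal_ne_top]
    refine mul_le_mul_right (le_trans (le_of_eq ?_) this) _
    simp only [Set.indicator, hmem, hρr, if_true]
    rw [setLIntegral_const, Real.volume_Ioo, mul_comm]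
    congr 2; ring
  · simp only [Set.indicator, hmem, hρr, if_false, mul_zero]
    simp

/-- Point evaluations are bounded, uniformly on smaller disks. -/
theorem exists_enorm_le_mul_eLpNorm {s : ℝ} (hs : s < 1) :
    ∃ C : ℝ≥0∞, C ≠ ∞ ∧ ∀ F : ℂ → ℂ, DifferentiableOn ℂ F (ball 0 1) →
      ∀ z ∈ closedBall (0 : ℂ) s, ‖F z‖ₑ ^ 2 ≤ C * eLpNorm F 2 diskMeasure ^ 2 := by
  set V : ℝ≥0∞ := volume (ball (0 : ℂ) 1) with hV
  have hV0 : V ≠ 0 := (measure_ball_pos volume _ one_pos).ne'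
  have hVt : V ≠ ∞ := measure_ball_lt_top.ne
  have hv0 : volume (ball (0 : ℂ) (1 - s)) ≠ 0 :=
    (measure_ball_pos volume _ (by linarith)).ne'
  have hvt : volume (ball (0 : ℂ) (1 - s)) ≠ ∞ := measure_ball_lt_top.ne
  refine ⟨(volume (ball (0 : ℂ) (1 - s)))⁻¹ * V,
    ENNReal.mul_ne_top (ENNReal.inv_ne_top.2 hv0) hVt, ?_⟩
  intro F hF z hz
  have hsub : ball z (1 - s) ⊆ ball 0 1 := by
    apply ball_subset_ball'
    have : dist z 0 ≤ s := hz
    linarith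
  have h1 := volume_ball_mul_enorm_le_lintegral (F := fun w => F w ^ 2) (z := z) (r := 1 - s)
    ((hF.mono hsub).pow 2)
  have hvol : volume (ball z (1 - s)) = volume (ball (0 : ℂ) (1 - s)) := by
    rw [Complex.volume_ball, Complex.volume_ball]
  have h2 : V * eLpNorm F 2 diskMeasure ^ 2 = ∫⁻ w in ball (0 : ℂ) 1, ‖F w‖ₑ ^ 2 := by
    rw [eLpNorm_eq_lintegral_rpow_enorm_toReal (by norm_num) (by norm_num), ← ENNReal.rpow_natCast,
      ← ENNReal.rpow_mul, diskMeasure, lintegral_smul_measure, ← hV]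
    simp only [ENNReal.toReal_ofNat, Nat.cast_ofNat, ENNReal.rpow_ofNat]
    rw [show (1 / (2 : ℝ)) * 2 = 1 by norm_num, ENNReal.rpow_one, smul_eq_mul, ← mul_assoc,
      ENNReal.mul_inv_cancel hV0 hVt, one_mul]
  rw [mul_assoc, h2, ← ENNReal.div_eq_inv_mul, ENNReal.le_div_iff_mul_le (Or.inl hv0) (Or.inl hvt),
    mul_comm, ← hvol]
  simp only [enorm_pow] at h1
  exact h1.trans (lintegral_mono_set hsub)

/-- The Bergman space is closed in `L²`. -/
theorem isClosed_bergmanSpace : IsClosed (bergmanSpace : Set (Lp ℂ 2 diskMeasure)) := by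
  apply IsSeqClosed.isClosed
  intro f f₀ hf hlim
  choose F hFd hFe using hf
  have hcau : ∀ s < 1, UniformCauchySeqOn F Filter.atTop (closedBall (0 : ℂ) s) := by
    intro s hs
    obtain ⟨C, hC, hb⟩ := exists_enorm_le_mul_eLpNorm hs
    rw [Metric.uniformCauchySeqOn_iff]
    intro ε hε
    have hK : 0 < C.toReal + 1 := by positivity
    obtain ⟨N, hN⟩ := Metric.cauchySeq_iff.1 hlim.cauchySeq (ε / √(C.toReal + 1)) (by positivity)
    refine ⟨N, fun p hp q hq z hz => ?_⟩
    have h1 := hb (F p - F q) ((hFd p).sub (hFd q)) z hz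
    have h2 : eLpNorm (F p - F q) 2 diskMeasure = ‖f p - f q‖ₑ := by
      rw [Lp.enorm_def]
      exact eLpNorm_congr_ae (((hFe p).sub (hFe q)).symm.trans (Lp.coeFn_sub _ _).symm)
    rw [h2] at h1
    have h3 := ENNReal.toReal_mono (ENNReal.mul_ne_top hC (by simp)) h1
    simp only [ENNReal.toReal_mul, ENNReal.toReal_pow, toReal_enorm, Pi.sub_apply] at h3
    have h4 := hN p hp q hq
    rw [dist_eq_norm, lt_div_iff₀ (by positivity)] at h4
    rw [dist_eq_norm]
    refine lt_of_pow_lt_pow_left₀ 2 hε.le (h3.trans_lt ?_)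
    have h5 := pow_lt_pow_left₀ h4 (by positivity) two_ne_zero
    rw [mul_pow, Real.sq_sqrt hK.le] at h5
    nlinarith [sq_nonneg ‖f p - f q‖]
  have hpt : ∀ z ∈ ball (0 : ℂ) 1, ∃ w, Filter.Tendsto (fun n => F n z) Filter.atTop (nhds w) := by
    intro z hz
    apply cauchySeq_tendsto_of_complete
    exact (hcau ‖z‖ (by simpa using hz)).cauchySeq (x := z) (by simp)
  choose! G hG using hpt
  have hloc : TendstoLocallyUniformlyOn F G Filter.atTop (ball 0 1) := by
    rw [tendstoLocallyUniformlyOn_iff_forall_isCompact isOpen_ball]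
    intro K hK hKc
    obtain ⟨s, hs, hKs⟩ : ∃ s < 1, K ⊆ closedBall (0 : ℂ) s := by
      rcases K.eq_empty_or_nonempty with rfl | hne
      · exact ⟨0, one_pos, Set.empty_subset _⟩
      · obtain ⟨w, hw, hmax⟩ := hKc.exists_isMaxOn hne continuous_norm.continuousOn
        exact ⟨‖w‖, by simpa using hK hw, fun z hz => by simpa using hmax hz⟩
    exact ((hcau s hs).mono hKs).tendstoUniformlyOn_of_tendsto (fun z hz => hG z (hK hz))
  refine ⟨G, hloc.differentiableOn (Filter.Eventually.of_forall hFd) isOpen_ball, ?_⟩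
  have hm := tendstoInMeasure_of_tendsto_Lp hlim
  obtain ⟨ns, hns, hae⟩ := hm.exists_seq_tendsto_ae
  have hball : ∀ᵐ z ∂diskMeasure, z ∈ ball (0 : ℂ) 1 :=
    Measure.ae_smul_measure (ae_restrict_mem measurableSet_ball) _
  filter_upwards [hae, hball, ae_all_iff.2 hFe] with z h1 h2 h3
  have h4 := (hG z h2).comp hns.tendsto_atTop
  refine tendsto_nhds_unique h1 (h4.congr fun n => ?_)
  simp [h3]

instance instCompleteSpaceBergmanSpace : CompleteSpace bergmanSpace :=
  isClosed_bergmanSpace.completeSpace_coe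

/-- The Toeplitz operator on the Bergman space with bounded symbol `φ`: the multiplication by `φ`
from the Bergman space to `L²`, followed by the orthogonal projection onto the Bergman space. -/
def toeplitz (φ : Lp ℂ ∞ diskMeasure) : bergmanSpace →L[ℂ] bergmanSpace :=
  bergmanSpace.orthogonalProjectionOnto ∘L
    (ContinuousLinearMap.mul ℂ ℂ).holderL diskMeasure ∞ 2 2 φ ∘L bergmanSpace.subtypeL

theorem memLp_top_polynomial (p : ℂ[X]) : MemLp (fun z => p.eval z) ∞ diskMeasure := by
  obtain ⟨C, hC⟩ := (isCompact_closedBall (0 : ℂ) 1).exists_bound_of_continuousOn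
    p.continuous.continuousOn
  refine memLp_top_of_bound p.continuous.aestronglyMeasurable C ?_
  have hball : ∀ᵐ z ∂diskMeasure, z ∈ ball (0 : ℂ) 1 :=
    Measure.ae_smul_measure (ae_restrict_mem measurableSet_ball) _
  filter_upwards [hball] with z hz
  exact hC z (ball_subset_closedBall hz)

/-- A complex polynomial, as a bounded function on the disk. -/
def polySymbol (p : ℂ[X]) : Lp ℂ ∞ diskMeasure :=
  (memLp_top_polynomial p).toLp (fun z => p.eval z)

end

/-! On the Bergman space a Toeplitz operator with polynomial symbol is multiplication by that
polynomial. For `w` in the disk write h(z^m) - h(w^m) = (z^m - w^m) r(z). If `r` has no zero on the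
closed disk, then (z^m - w^m) g = (h(z^m) - h(w^m)) (g/r) with g/r again in the space. Applying `S`
and evaluating at `w` gives S(z^m g)(w) = w^m (S g)(w) (`rep_apply_toeplitz_apply`). If such `w`
fill a nonempty open set, the identity theorem gives commutation with multiplication by z^m.

The main point is therefore to find `v` in the closed disk at which (h(u) - h(v))/(u - v) has no
zero `u` in the closed disk (`Polynomial.exists_diffQuot_ne_zero`). Otherwise every `v` has a
partner u(v). For infinitely many unimodular `v`, the value h(v) is not attained in the open disk,
so u(v) is unimodular too. Since conjugation is inversion on the circle, h(u) = h(v) also yields a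
polynomial equation in 1/u and 1/v. Viewed in an ultrapower of ℂ, the two equations bound u/v in
every valuation trivial on ℂ, so u/v is a constant `c`. Then c = 1 forces h' = 0, while c ≠ 1 makes
`h` a polynomial in a proper power.

If `S` is compact, it sends the normalized monomials to a null sequence, whereas commutation with
z^m keeps the matrix entries along a diagonal bounded below unless they vanish. -/

/-! ### Valuations trivial on the constants. -/

/-- If every monomial of `p` has valuation less than `M ^ n` at `b`, so does `p`. -/
theorem Valuation.map_eval₂_lt_pow {R K Γ : Type*} [CommRing R] [Field K]
    [LinearOrderedCommGroupWithZero Γ] (v : Valuation K Γ) (ι : R →+* K)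
    (hι : ∀ c, v (ι c) ≤ 1) (p : R[X]) {n : ℕ} {b : K} {M : Γ} (hM : 1 < M)
    (hp : ∀ k ∈ p.support, v b ^ k < M ^ n) : v (p.eval₂ ι b) < M ^ n := by
  rw [eval₂_eq_sum, Polynomial.sum]
  refine v.map_sum_lt (pow_ne_zero _ (zero_lt_one.trans hM).ne') fun k hk => ?_
  rw [map_mul, map_pow]
  exact (mul_le_of_le_one_left' (hι _)).trans_lt (hp k hk)

/-- For a valuation trivial on the coefficients, a nonconstant polynomial is strictly monotone at
elements of valuation greater than `1`. -/
theorem Valuation.map_eval₂_lt_map_eval₂ {k K Γ : Type*} [Field k] [Field K]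
    [LinearOrderedCommGroupWithZero Γ] (v : Valuation K Γ) (ι : k →+* K)
    (hι : ∀ c, v (ι c) ≤ 1) (p : k[X]) (hp : p.natDegree ≠ 0) {a b : K} (ha : 1 < v a)
    (hab : v b < v a) : v (p.eval₂ ι b) < v (p.eval₂ ι a) := by
  have hp0 : p.leadingCoeff ≠ 0 := by
    rw [Ne, leadingCoeff_eq_zero]; rintro rfl; simp at hp
  have hlc : v (ι p.leadingCoeff) = 1 := by
    refine le_antisymm (hι _) ?_
    have h1 : v (ι p.leadingCoeff) * v (ι p.leadingCoeff⁻¹) = 1 := by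
      rw [← map_mul, ← map_mul, mul_inv_cancel₀ hp0, map_one, map_one]
    rw [← h1]
    exact mul_le_of_le_one_right' (hι _)
  have hlow : v (p.eraseLead.eval₂ ι a) < v a ^ p.natDegree :=
    v.map_eval₂_lt_pow ι hι _ ha fun k hk =>
      pow_lt_pow_right₀ ha (lt_natDegree_of_mem_eraseLead_support hk)
  have hva : v (p.eval₂ ι a) = v a ^ p.natDegree := by
    conv_lhs => rw [← p.eraseLead_add_C_mul_X_pow]
    rw [eval₂_add, eval₂_mul, eval₂_C, eval₂_X_pow]
    have h2 : v (ι p.leadingCoeff * a ^ p.natDegree) = v a ^ p.natDegree := by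
      rw [map_mul, map_pow, hlc, one_mul]
    rw [v.map_add_eq_of_lt_right (by rwa [h2]), h2]
  rw [hva]
  refine v.map_eval₂_lt_pow ι hι _ ha fun j hj => ?_
  -- The constant term is separate: `hab` gives no strict inequality between zeroth powers, so it is
  -- beaten through `1 < v a` and the nonzero degree.
  rcases eq_or_ne j 0 with rfl | hj0
  · rw [pow_zero]; exact one_lt_pow₀ ha hp
  · exact (pow_lt_pow_left₀ hab zero_le hj0).trans_le
      (pow_le_pow_right₀ ha.le (le_natDegree_of_mem_supp j hj))

/-- An element lying in every valuation subring that contains an algebraically closed subfield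
lies in that subfield. -/
theorem exists_eq_of_forall_valuationSubring {k K : Type*} [Field k] [IsAlgClosed k] [Field K]
    (ι : k →+* K) (x : K)
    (hx : ∀ V : ValuationSubring K, (∀ c, ι c ∈ V) → x ∈ V) : ∃ c, x = ι c := by
  have h1 : x ∈ (⨅ V : {V : ValuationSubring K // Set.range ι ⊆ V.toSubring}, V.1.toSubring) := by
    rw [Subring.mem_iInf]
    exact fun V => hx V.1 fun c => V.2 ⟨c, rfl⟩
  -- The valuation subrings containing a given subring intersect in its integral closure; here that
  -- subring is the field `k` itself.
  rw [iInf_valuationSubring_superset] at h1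
  have h2 : IsIntegral (Subring.closure (Set.range ι)) x := h1
  let _ := ι.toAlgebra
  have h3 : ∀ y : Subring.closure (Set.range ι), ∃ c, ι c = y := by
    rintro ⟨y, hy⟩
    have : Subring.closure (Set.range ι) ≤ ι.range := Subring.closure_le.2 (by simp)
    exact this hy
  obtain ⟨p, hpm, hp⟩ := h2
  have h4 : p.map (algebraMap _ K) ∈ lifts ι := by
    rw [lifts_iff_coeff_lifts]
    intro n
    rw [coeff_map]
    exact h3 _
  obtain ⟨q, hq, -, hqm⟩ := lifts_and_natDegree_eq_and_monic h4 (hpm.map _)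
  have h5 : IsIntegral k x := by
    refine ⟨q, hqm, ?_⟩
    rw [← eval_map]
    change eval x (q.map ι) = 0
    rw [hq, eval_map]
    exact hp
  obtain ⟨c, hc⟩ := minpoly.mem_range_of_degree_eq_one k x
    (IsAlgClosed.degree_eq_one_of_irreducible k (minpoly.irreducible h5))
  exact ⟨c, hc.symm⟩

/-- If `p(w) = p(z)` and `q(w⁻¹) = q(z⁻¹)` for nonconstant polynomials `p`, `q` over an
algebraically closed subfield, then `w` is a constant multiple of `z`. -/
theorem exists_eq_const_mul_of_eval₂_eq {k K : Type*} [Field k] [IsAlgClosed k] [Field K]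
    (ι : k →+* K) {p q : k[X]} (hp : p.natDegree ≠ 0) (hq : q.natDegree ≠ 0) {z w : K}
    (hz : z ≠ 0) (hw : w ≠ 0) (h1 : p.eval₂ ι w = p.eval₂ ι z)
    (h2 : q.eval₂ ι w⁻¹ = q.eval₂ ι z⁻¹) : ∃ c, w = ι c * z := by
  obtain ⟨c, hc⟩ := exists_eq_of_forall_valuationSubring ι (w / z) (by
    intro V hV
    rw [← V.valuation_le_one_iff, map_div₀, div_le_one₀ (by simpa [zero_lt_iff] using hz)]
    by_contra! hlt
    have hι : ∀ c, V.valuation (ι c) ≤ 1 := fun c => (V.valuation_le_one_iff _).2 (hV c)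
    -- If `w` is large, `p` separates `w` from `z`. Otherwise `z` has valuation below 1, so `z⁻¹` is
    -- large and `q` separates the inverses.
    rcases lt_or_ge 1 (V.valuation w) with hw1 | hw1
    · exact (V.valuation.map_eval₂_lt_map_eval₂ ι hι p hp hw1 hlt).ne
        (congrArg _ h1.symm)
    · have hz0 : 0 < V.valuation z := by simpa [zero_lt_iff] using hz
      have hw0 : 0 < V.valuation w := by simpa [zero_lt_iff] using hw
      refine (V.valuation.map_eval₂_lt_map_eval₂ ι hι q hq (a := z⁻¹) (b := w⁻¹) ?_ ?_).ne
        (congrArg _ h2)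
      · rw [map_inv₀]; exact (one_lt_inv₀ hz0).2 (hlt.trans_le hw1)
      · rw [map_inv₀, map_inv₀]; exact inv_strictAnti₀ hz0 hlt)
  exact ⟨c, by rw [← hc, div_mul_cancel₀ _ hz]⟩

/-! ### Coincidences of a polynomial on the unit circle, via an ultrapower. -/

theorem Filter.Germ.eval₂_const_coe {α k : Type*} [Field k] (l : Ultrafilter α) (p : k[X])
    (f : α → k) :
    p.eval₂ ((Filter.Germ.coeRingHom (l : Filter α)).comp (Pi.constRingHom α k))
      (f : Filter.Germ (l : Filter α) k) = ((fun i => p.eval (f i) : α → k) : Filter.Germ (l : Filter α) k) := by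
  have h1 : p.eval₂ (Pi.constRingHom α k) f = fun i => p.eval (f i) := by
    ext i
    change Pi.evalRingHom (fun _ : α => k) i _ = _
    rw [hom_eval₂]
    rfl
  have h2 := hom_eval₂ p (Pi.constRingHom α k) (Filter.Germ.coeRingHom (l : Filter α)) f
  rw [h1] at h2
  exact h2.symm

/-- If a nonconstant polynomial takes equal values at infinitely many pairs of points of the unit
circle, then infinitely many of these pairs differ by the same rotation. -/
theorem exists_infinite_eq_mul_of_eval_eq {p : ℂ[X]} (hp : p.natDegree ≠ 0) {V : Set ℂ}
    (hV : V.Infinite) (hV1 : ∀ v ∈ V, ‖v‖ = 1) (u : ℂ → ℂ) (hu : ∀ v ∈ V, ‖u v‖ = 1)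
    (hpu : ∀ v ∈ V, p.eval (u v) = p.eval v) :
    ∃ c, {v ∈ V | u v = c * v}.Infinite := by
  have : Infinite V := hV.to_subtype
  -- A nonprincipal ultrafilter: an identity between germs holds on an infinite set of indices.
  let l : Ultrafilter V := Filter.hyperfilter V
  let ι := (Filter.Germ.coeRingHom (l : Filter V)).comp (Pi.constRingHom V ℂ)
  let z : Filter.Germ (l : Filter V) ℂ := ((fun v => v : V → ℂ) : Filter.Germ (l : Filter V) ℂ)
  let w : Filter.Germ (l : Filter V) ℂ := ((fun v => u v : V → ℂ) : Filter.Germ (l : Filter V) ℂ)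
  have ne0 : ∀ f : V → ℂ, (∀ v, ‖f v‖ = 1) → (f : Filter.Germ (l : Filter V) ℂ) ≠ 0 := by
    intro f hf h0
    obtain ⟨v, hv⟩ := (Filter.Germ.coe_eq.1 h0).exists
    have := hf v
    rw [hv] at this
    simp at this
  -- Conjugating p(u) = p(v) on the circle gives the second equation, for the polynomial with
  -- conjugate coefficients at the inverses.
  have inv : ∀ a : ℂ, ‖a‖ = 1 → a⁻¹ = (starRingEnd ℂ) a := fun a ha => by
    rw [Complex.inv_def, Complex.normSq_eq_norm_sq, ha]; simp
  have hq : (p.map (starRingEnd ℂ)).natDegree ≠ 0 := by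
    rwa [natDegree_map]
  obtain ⟨c, hc⟩ := exists_eq_const_mul_of_eval₂_eq ι hp hq (z := z) (w := w)
    (ne0 _ fun v => hV1 v v.2) (ne0 _ fun v => hu v v.2) (by
      rw [Filter.Germ.eval₂_const_coe, Filter.Germ.eval₂_const_coe]
      congr 1
      ext v
      exact hpu v v.2) (by
      rw [← Filter.Germ.coe_inv, ← Filter.Germ.coe_inv, Filter.Germ.eval₂_const_coe,
        Filter.Germ.eval₂_const_coe]
      congr 1
      ext v
      simp only [Pi.inv_apply]
      rw [inv _ (hu v v.2), inv _ (hV1 v v.2), eval_map, eval_map, eval₂_at_apply,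
        eval₂_at_apply, hpu v v.2])
  refine ⟨c, ?_⟩
  have hc' : ∀ᶠ v : V in (l : Filter V), u v = c * v := Filter.Germ.coe_eq.1 hc
  have h3 : {v : V | u v = c * v}.Infinite := by
    intro hfin
    exact hfin.notMem_hyperfilter hc'
  refine (h3.image (Subtype.val_injective.injOn)).mono ?_
  rintro _ ⟨v, hv, rfl⟩
  exact ⟨v.2, hv⟩

/-! ### The difference quotient and its zeros on the closed disk. -/

/-- The difference quotient `(p(u) - p(v)) / (u - v)` of a polynomial, as a polynomial in the two
variables. -/
noncomputable def Polynomial.diffQuot (p : ℂ[X]) (u v : ℂ) : ℂ :=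
  p.sum fun k a => a * ∑ i ∈ Finset.range k, u ^ i * v ^ (k - 1 - i)

theorem Polynomial.diffQuot_mul (p : ℂ[X]) (u v : ℂ) :
    p.diffQuot u v * (u - v) = p.eval u - p.eval v := by
  rw [diffQuot, eval_eq_sum, eval_eq_sum, Polynomial.sum, Polynomial.sum, Polynomial.sum,
    Finset.sum_mul, ← Finset.sum_sub_distrib]
  refine Finset.sum_congr rfl fun k _ => ?_
  rw [mul_assoc, (Commute.all u v).geom_sum₂_mul, mul_sub]

theorem Polynomial.diffQuot_self (p : ℂ[X]) (u : ℂ) : p.diffQuot u u = p.derivative.eval u := by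
  rw [diffQuot, derivative_eval]
  refine Finset.sum_congr rfl fun k _ => ?_
  dsimp only
  rw [geom_sum₂_self, mul_assoc]

theorem Polynomial.continuous_diffQuot (p : ℂ[X]) :
    Continuous fun x : ℂ × ℂ => p.diffQuot x.1 x.2 := by
  unfold diffQuot Polynomial.sum
  fun_prop

/-- A polynomial invariant under a nontrivial rotation is a polynomial in a power of the
variable. -/
theorem Polynomial.exists_eq_comp_X_pow {p : ℂ[X]} (hp : p.natDegree ≠ 0) {c : ℂ} (hc : c ≠ 1)
    (hpc : ∀ z, p.eval (c * z) = p.eval z) : ∃ (q : ℂ[X]) (l : ℕ), 1 < l ∧ p = q.comp (X ^ l) := by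
  have h1 : p.comp (C c * X) = p := Polynomial.funext fun z => by simpa using hpc z
  have h2 : ∀ n, p.coeff n ≠ 0 → c ^ n = 1 := by
    intro n hn
    have := congrArg (fun q => q.coeff n) h1
    simp only [comp_C_mul_X_coeff] at this
    exact mul_left_cancel₀ hn (by rw [this, mul_one])
  have h3 : ∀ n, p.coeff n ≠ 0 → orderOf c ∣ n := fun n hn => orderOf_dvd_of_pow_eq_one (h2 n hn)
  have hl : p.coeff p.natDegree ≠ 0 := by
    rw [coeff_natDegree, Ne, leadingCoeff_eq_zero]; rintro rfl; simp at hp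
  -- Order 0 means that `c` is not a root of unity; then only the exponent 0 could occur in `p`.
  have h0 : orderOf c ≠ 0 := fun h => hp (by simpa [h] using h3 _ hl)
  have h1' : orderOf c ≠ 1 := by rwa [Ne, orderOf_eq_one_iff]
  refine ⟨p.contract (orderOf c), orderOf c, by omega, ?_⟩
  rw [← expand_eq_comp_X_pow]
  ext n
  rw [coeff_expand (by omega), coeff_contract h0]
  split_ifs with hn
  · rw [Nat.div_mul_cancel hn]
  · by_contra h
    exact hn (h3 n h)

/-- Infinitely many points of the unit circle are mapped by a nonconstant polynomial to values not
taken on the open disk. -/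
theorem Polynomial.infinite_setOf_forall_norm_eq_one {p : ℂ[X]} (hp : p.natDegree ≠ 0) :
    {v : ℂ | ‖v‖ = 1 ∧ ∀ u ∈ closedBall (0 : ℂ) 1, p.eval u = p.eval v → ‖u‖ = 1}.Infinite := by
  have hopen : IsOpenMap p.eval := (isOpenQuotientMap_eval p hp).isOpenMap
  have h1 : (((fun z : ℂ => z.re) ∘ p.eval) '' ball 0 1).Infinite := by
    refine infinite_of_mem_nhds (p.eval 0).re (IsOpen.mem_nhds ?_ ⟨0, by simp, rfl⟩)
    exact (Complex.isOpenMap_re.comp hopen) _ isOpen_ball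
  refine Set.Infinite.of_image ((fun z : ℂ => z.re) ∘ p.eval) (h1.mono ?_)
  rintro _ ⟨w, hw, rfl⟩
  -- On each vertical line meeting the image of the open disk, take the highest value over the
  -- closed disk. Distinct lines give distinct `v`.
  obtain ⟨v, ⟨hv, hvw⟩, hmax⟩ := IsCompact.exists_isMaxOn
    (s := closedBall (0 : ℂ) 1 ∩ {u | (p.eval u).re = (p.eval w).re})
    (f := fun u => (p.eval u).im)
    ((isCompact_closedBall 0 1).inter_right
      (isClosed_eq (Complex.continuous_re.comp p.continuous) continuous_const))
    ⟨w, ball_subset_closedBall hw, rfl⟩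
    (Complex.continuous_im.comp p.continuous).continuousOn
  -- Were the value attained in the open disk, openness of `p` would yield a strictly higher value
  -- on the same vertical line.
  have key : ∀ u ∈ closedBall (0 : ℂ) 1, p.eval u = p.eval v → ‖u‖ = 1 := by
    intro u hu huv
    by_contra hne
    have hu1 : u ∈ ball (0 : ℂ) 1 := by
      rw [mem_ball_zero_iff]
      exact lt_of_le_of_ne (mem_closedBall_zero_iff.1 hu) hne
    have hmem : p.eval '' ball 0 1 ∈ nhds (p.eval v) :=
      (hopen _ isOpen_ball).mem_nhds ⟨u, hu1, huv⟩
    have ht : Filter.Tendsto (fun t : ℝ => p.eval v + t * Complex.I) (nhdsWithin 0 (Set.Ioi 0))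
        (nhds (p.eval v)) := by
      have : ContinuousAt (fun t : ℝ => p.eval v + t * Complex.I) 0 := by fun_prop
      have h2 := this.tendsto
      simp only [Complex.ofReal_zero, zero_mul, add_zero] at h2
      exact h2.mono_left nhdsWithin_le_nhds
    obtain ⟨t, ⟨u', hu', hu'v⟩, ht0⟩ := ((ht.eventually_mem hmem).and self_mem_nhdsWithin).exists
    have h3 := hmax ⟨ball_subset_closedBall hu', by
      simp only [Set.mem_ofPred_eq, hu'v]; simpa using hvw⟩
    simp only [Set.mem_ofPred_eq, hu'v] at h3
    have : (0 : ℝ) < t := ht0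
    simp at h3
    linarith
  exact ⟨v, ⟨key v hv rfl, key⟩, hvw⟩

/-- For a nonconstant polynomial which is not a polynomial in a proper power of the variable, there
is a point of the closed disk at which the difference quotient has no zero on the closed disk. -/
theorem Polynomial.exists_diffQuot_ne_zero {p : ℂ[X]}
    (hp : ∀ (q : ℂ[X]) (l : ℕ), 1 < l → p ≠ q.comp (X ^ l)) :
    ∃ v ∈ closedBall (0 : ℂ) 1, ∀ u ∈ closedBall (0 : ℂ) 1, p.diffQuot u v ≠ 0 := by
  have hdeg : p.natDegree ≠ 0 := by
    -- A constant is a polynomial in X^2, so the hypothesis excludes it.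
    intro h0
    refine hp p 2 one_lt_two ?_
    rw [eq_C_of_natDegree_eq_zero h0, C_comp]
  by_contra! hcon
  choose! u hu hu0 using hcon
  have hinf := infinite_setOf_forall_norm_eq_one hdeg
  set V := {v : ℂ | ‖v‖ = 1 ∧ ∀ u ∈ closedBall (0 : ℂ) 1, p.eval u = p.eval v → ‖u‖ = 1}
  have hVb : ∀ v ∈ V, v ∈ closedBall (0 : ℂ) 1 := fun v hv => by simpa using hv.1.le
  have heq : ∀ v ∈ V, p.eval (u v) = p.eval v := by
    intro v hv
    have := p.diffQuot_mul (u v) v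
    rw [hu0 v (hVb v hv), zero_mul] at this
    exact (sub_eq_zero.1 this.symm)
  obtain ⟨c, hc⟩ := exists_infinite_eq_mul_of_eval_eq hdeg hinf (fun v hv => hv.1) u
    (fun v hv => hv.2 _ (hu v (hVb v hv)) (heq v hv)) heq
  rcases eq_or_ne c 1 with rfl | hc1
  · have h1 : p.derivative = 0 := by
      refine eq_zero_of_infinite_isRoot _ (hc.mono ?_)
      rintro v ⟨hv, hvu⟩
      rw [one_mul] at hvu
      have := hu0 v (hVb v hv)
      rw [hvu, diffQuot_self] at this
      exact this
    exact hdeg (derivative_eq_zero.1 h1)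
  · have h1 : p.comp (C c * X) = p := by
      refine eq_of_infinite_eval_eq _ _ (hc.mono ?_)
      rintro v ⟨hv, hvu⟩
      simp only [Set.mem_ofPred_eq, eval_comp, eval_mul, eval_C, eval_X]
      rw [← hvu, heq v hv]
    obtain ⟨q, l, hl, hq⟩ := exists_eq_comp_X_pow hdeg hc1 fun z => by
      conv_rhs => rw [← h1]
      simp
    exact hp q l hl hq

/-- The set of points at which the difference quotient has no zero on the closed disk is open. -/
theorem Polynomial.isOpen_setOf_diffQuot_ne_zero (p : ℂ[X]) :
    IsOpen {v : ℂ | ∀ u ∈ closedBall (0 : ℂ) 1, p.diffQuot u v ≠ 0} := by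
  refine isOpen_iff_mem_nhds.2 fun v hv => ?_
  -- Tube lemma: `u` ranges over a compact set.
  refine (isCompact_closedBall (0 : ℂ) 1).eventually_forall_of_forall_eventually fun u hu => ?_
  exact (p.continuous_diffQuot.comp continuous_swap).continuousAt.eventually_ne (hv u hu)

/-! ### Holomorphic representatives in the Bergman space. -/

theorem ae_diskMeasure_mem_ball : ∀ᵐ z ∂diskMeasure, z ∈ ball (0 : ℂ) 1 :=
  Measure.ae_smul_measure (ae_restrict_mem measurableSet_ball) _

theorem diskMeasure_eq_smul : diskMeasure = ENNReal.ofReal Real.pi⁻¹ • volume.restrict (ball 0 1) := by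
  have : volume (ball (0 : ℂ) 1) = ENNReal.ofReal Real.pi := by
    rw [Complex.volume_ball, ENNReal.ofReal_one, one_pow, one_mul, ENNReal.ofReal]
    congr 1
    ext
    simp [Real.pi_pos.le]
  rw [diskMeasure, this, ENNReal.ofReal_inv_of_pos Real.pi_pos]

instance instIsProbabilityMeasureDiskMeasure : IsProbabilityMeasure diskMeasure := by
  constructor
  rw [diskMeasure, Measure.smul_apply, Measure.restrict_apply_univ, smul_eq_mul,
    ENNReal.inv_mul_cancel (measure_ball_pos volume _ one_pos).ne' measure_ball_lt_top.ne]

theorem ae_volume_restrict_of_ae_diskMeasure {p : ℂ → Prop} (h : ∀ᵐ z ∂diskMeasure, p z) :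
    ∀ᵐ z ∂volume.restrict (ball (0 : ℂ) 1), p z := by
  rw [diskMeasure_eq_smul] at h
  rw [ae_iff, Measure.smul_apply, smul_eq_mul, mul_eq_zero] at h
  exact h.resolve_left (by simp [Real.pi_pos])

/-- Holomorphic functions on the disk that are almost everywhere equal are equal on the disk. -/
theorem eqOn_ball_of_ae_eq {F G : ℂ → ℂ} (hF : DifferentiableOn ℂ F (ball 0 1))
    (hG : DifferentiableOn ℂ G (ball 0 1)) (h : F =ᵐ[diskMeasure] G) :
    Set.EqOn F G (ball 0 1) :=
  Measure.eqOn_open_of_ae_eq (ae_volume_restrict_of_ae_diskMeasure h) isOpen_ball hF.continuousOn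
    hG.continuousOn

theorem ae_eq_of_eqOn_ball {F G : ℂ → ℂ} (h : Set.EqOn F G (ball 0 1)) : F =ᵐ[diskMeasure] G := by
  filter_upwards [ae_diskMeasure_mem_ball] with z hz using h hz

theorem ContinuousOn.aestronglyMeasurable_diskMeasure {F : ℂ → ℂ}
    (hF : ContinuousOn F (ball 0 1)) : AEStronglyMeasurable F diskMeasure := by
  rw [diskMeasure]
  exact (hF.aestronglyMeasurable measurableSet_ball).smul_measure _

namespace bergmanSpace

/-- The holomorphic representative of an element of the Bergman space. -/
noncomputable def rep (f : bergmanSpace) : ℂ → ℂ := f.2.choose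

theorem differentiableOn_rep (f : bergmanSpace) : DifferentiableOn ℂ (rep f) (ball 0 1) :=
  f.2.choose_spec.1

theorem coeFn_ae_eq_rep (f : bergmanSpace) : (f : Lp ℂ 2 diskMeasure) =ᵐ[diskMeasure] rep f :=
  f.2.choose_spec.2

theorem memLp_rep (f : bergmanSpace) : MemLp (rep f) 2 diskMeasure :=
  (memLp_congr_ae (coeFn_ae_eq_rep f)).1 (Lp.memLp _)

theorem eqOn_rep {f : bergmanSpace} {F : ℂ → ℂ} (hF : DifferentiableOn ℂ F (ball 0 1))
    (h : (f : Lp ℂ 2 diskMeasure) =ᵐ[diskMeasure] F) : Set.EqOn (rep f) F (ball 0 1) :=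
  eqOn_ball_of_ae_eq (differentiableOn_rep f) hF ((coeFn_ae_eq_rep f).symm.trans h)

theorem ext_rep {f g : bergmanSpace} (h : Set.EqOn (rep f) (rep g) (ball 0 1)) : f = g :=
  Subtype.ext <| Lp.ext <|
    (coeFn_ae_eq_rep f).trans ((ae_eq_of_eqOn_ball h).trans (coeFn_ae_eq_rep g).symm)

theorem eqOn_rep_sub (f g : bergmanSpace) :
    Set.EqOn (rep (f - g)) (rep f - rep g) (ball 0 1) :=
  eqOn_rep ((differentiableOn_rep f).sub (differentiableOn_rep g))
    ((Lp.coeFn_sub _ _).trans ((coeFn_ae_eq_rep f).sub (coeFn_ae_eq_rep g)))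

theorem eqOn_rep_smul (c : ℂ) (f : bergmanSpace) :
    Set.EqOn (rep (c • f)) (c • rep f) (ball 0 1) :=
  eqOn_rep ((differentiableOn_rep f).const_smul c)
    ((Lp.coeFn_smul _ _).trans ((coeFn_ae_eq_rep f).const_smul c))

theorem eqOn_rep_zero : Set.EqOn (rep 0) 0 (ball 0 1) :=
  eqOn_rep (differentiableOn_const 0) (Lp.coeFn_zero _ _ _)

theorem exists_eqOn_rep {F : ℂ → ℂ} (hF : DifferentiableOn ℂ F (ball 0 1))
    (hF2 : MemLp F 2 diskMeasure) : ∃ f, Set.EqOn (rep f) F (ball 0 1) :=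
  ⟨⟨hF2.toLp F, F, hF, hF2.coeFn_toLp⟩, eqOn_rep hF hF2.coeFn_toLp⟩

/-- The Bergman space is stable under multiplication by holomorphic functions that are continuous
on the closed disk. -/
theorem exists_eqOn_rep_mul {φ : ℂ → ℂ} (hφ : DifferentiableOn ℂ φ (ball 0 1))
    (hφc : ContinuousOn φ (closedBall 0 1)) (f : bergmanSpace) :
    ∃ g, Set.EqOn (rep g) (φ * rep f) (ball 0 1) := by
  obtain ⟨C, hC⟩ := (isCompact_closedBall (0 : ℂ) 1).exists_bound_of_continuousOn hφc
  have h1 : MemLp φ ∞ diskMeasure := by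
    refine memLp_top_of_bound hφ.continuousOn.aestronglyMeasurable_diskMeasure C ?_
    filter_upwards [ae_diskMeasure_mem_ball] with z hz using hC z (ball_subset_closedBall hz)
  exact exists_eqOn_rep (hφ.mul (differentiableOn_rep f)) ((memLp_rep f).mul h1)

/-- The monomial `z ^ n` represents an element of the Bergman space. -/
theorem exists_eqOn_rep_pow (n : ℕ) :
    ∃ f, Set.EqOn (rep f) (fun z => z ^ n) (ball 0 1) := by
  refine exists_eqOn_rep (by fun_prop) ?_
  have := (memLp_top_polynomial (X ^ n)).mono_exponent (p := 2) le_top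
  simpa using this

/-- A Toeplitz operator with polynomial symbol is a multiplication operator. -/
theorem eqOn_rep_toeplitz (p : ℂ[X]) (f : bergmanSpace) :
    Set.EqOn (rep (toeplitz (polySymbol p) f)) (fun z => p.eval z * rep f z) (ball 0 1) := by
  set g : Lp ℂ 2 diskMeasure :=
    (ContinuousLinearMap.mul ℂ ℂ).holderL diskMeasure ∞ 2 2 (polySymbol p) f with hg
  have hd : DifferentiableOn ℂ (fun z => p.eval z * rep f z) (ball 0 1) :=
    p.differentiable.differentiableOn.mul (differentiableOn_rep f)
  have hae : g =ᵐ[diskMeasure] fun z => p.eval z * rep f z := by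
    have h1 : g =ᵐ[diskMeasure] fun z =>
        ContinuousLinearMap.mul ℂ ℂ (polySymbol p z) ((f : Lp ℂ 2 diskMeasure) z) :=
      ContinuousLinearMap.coeFn_holder _ _ _
    filter_upwards [h1, coeFn_ae_eq_rep f, (memLp_top_polynomial p).coeFn_toLp] with z h1 h2 h3
    rw [h1, h2, ContinuousLinearMap.mul_apply', polySymbol, h3]
  have hmem : g ∈ bergmanSpace := ⟨_, hd, hae⟩
  -- The product is already holomorphic, so the projection fixes it.
  have h2 : toeplitz (polySymbol p) f = ⟨g, hmem⟩ :=
    bergmanSpace.orthogonalProjectionOnto_mem_subspace_eq_self ⟨g, hmem⟩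
  rw [h2]
  exact eqOn_rep hd hae

/-! ### Commutation with multiplication by z^m. -/

/-- If `S` commutes with multiplication by `p`, and `p - p(w)` is `q - q(w)` times a function
without zeros on the closed disk, then `S` intertwines multiplication by `q` with the scalar `q(w)`
at `w`. -/
theorem rep_apply_toeplitz_apply {S : bergmanSpace →L[ℂ] bergmanSpace} {p q : ℂ[X]}
    (hS : S ∘L toeplitz (polySymbol p) = toeplitz (polySymbol p) ∘L S) {r : ℂ → ℂ}
    (hr : Differentiable ℂ r) (hr0 : ∀ z ∈ closedBall (0 : ℂ) 1, r z ≠ 0) {w : ℂ}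
    (hw : w ∈ ball (0 : ℂ) 1) (hpq : ∀ z, p.eval z - p.eval w = (q.eval z - q.eval w) * r z)
    (g : bergmanSpace) :
    rep (S (toeplitz (polySymbol q) g)) w = q.eval w * rep (S g) w := by
  -- `k` is g/r.
  obtain ⟨k, hk⟩ := exists_eqOn_rep_mul (φ := fun z => (r z)⁻¹)
    (hr.differentiableOn.inv fun z hz => hr0 z (ball_subset_closedBall hz))
    (hr.continuous.continuousOn.inv₀ hr0) g
  have h1 : toeplitz (polySymbol q) g - q.eval w • g
      = toeplitz (polySymbol p) k - p.eval w • k := by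
    refine ext_rep fun z hz => ?_
    rw [eqOn_rep_sub _ _ hz, eqOn_rep_sub _ _ hz]
    simp only [Pi.sub_apply]
    rw [eqOn_rep_toeplitz _ _ hz, eqOn_rep_toeplitz _ _ hz, eqOn_rep_smul _ _ hz,
      eqOn_rep_smul _ _ hz]
    simp only [Pi.smul_apply, smul_eq_mul]
    rw [← sub_mul, ← sub_mul, hk hz, hpq]
    simp only [Pi.mul_apply]
    field_simp [hr0 z (ball_subset_closedBall hz)]
  have h2 : S (toeplitz (polySymbol p) k) = toeplitz (polySymbol p) (S k) := DFunLike.congr_fun hS k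
  have h3 := congrArg (fun f => rep (S f) w) h1
  simp only [map_sub, map_smul, h2] at h3
  rw [eqOn_rep_sub _ _ hw, eqOn_rep_sub _ _ hw] at h3
  simp only [Pi.sub_apply] at h3
  rw [eqOn_rep_toeplitz _ _ hw, eqOn_rep_smul _ _ hw, eqOn_rep_smul _ _ hw] at h3
  simp only [Pi.smul_apply, smul_eq_mul, sub_self] at h3
  exact sub_eq_zero.1 h3

/-- The pointwise identity applies with r(u) the difference quotient of `h` at (u^m, z^m), for `z`
in a nonempty open set; analytic continuation does the rest. -/
theorem commute_toeplitz_X_pow {h : ℂ[X]}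
    (hh : ∀ (h₁ : ℂ[X]) (l : ℕ), 1 < l → h ≠ h₁.comp (X ^ l)) {m : ℕ} (hm : 1 ≤ m)
    {S : bergmanSpace →L[ℂ] bergmanSpace}
    (hS : S ∘L toeplitz (polySymbol (h.comp (X ^ m))) =
      toeplitz (polySymbol (h.comp (X ^ m))) ∘L S) :
    S ∘L toeplitz (polySymbol (X ^ m)) = toeplitz (polySymbol (X ^ m)) ∘L S := by
  obtain ⟨v, hv, hv0⟩ := exists_diffQuot_ne_zero hh
  obtain ⟨w, rfl⟩ := IsAlgClosed.exists_pow_nat_eq v (by omega : 0 < m)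
  have hw : w ∈ closedBall (0 : ℂ) 1 := by
    rw [mem_closedBall_zero_iff, norm_pow] at hv
    rw [mem_closedBall_zero_iff]
    by_contra! hlt
    exact hv.not_gt (one_lt_pow₀ hlt (by omega))
  have hU := h.isOpen_setOf_diffQuot_ne_zero.preimage (continuous_pow (M := ℂ) m)
  rw [← closure_ball (0 : ℂ) one_ne_zero] at hw
  -- The good point may lie on the circle; openness of the condition moves it inside.
  obtain ⟨w₀, hw₀, hw₀b⟩ := mem_closure_iff.1 hw _ hU hv0
  refine ContinuousLinearMap.ext fun g => ext_rep ?_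
  refine AnalyticOnNhd.eqOn_of_preconnected_of_eventuallyEq
    ((differentiableOn_rep _).analyticOnNhd isOpen_ball)
    ((differentiableOn_rep _).analyticOnNhd isOpen_ball)
    (convex_ball (0 : ℂ) 1).isPreconnected hw₀b ?_
  filter_upwards [hU.mem_nhds hw₀, isOpen_ball.mem_nhds hw₀b] with z hz hzb
  simp only [ContinuousLinearMap.comp_apply]
  rw [eqOn_rep_toeplitz _ _ hzb]
  refine rep_apply_toeplitz_apply (r := fun u => h.diffQuot (u ^ m) (z ^ m)) hS ?_ ?_ hzb ?_ g
  · unfold diffQuot Polynomial.sum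
    fun_prop
  · intro u hu
    refine hz _ ?_
    rw [mem_closedBall_zero_iff] at hu ⊢
    rw [norm_pow]
    exact pow_le_one₀ (norm_nonneg _) hu
  · intro u
    simp only [eval_comp, eval_pow, eval_X]
    rw [mul_comm, diffQuot_mul]

end bergmanSpace

/-! ### Taylor coefficients as inner products with monomials. -/

/-- Cauchy's formula for the Taylor coefficients, over the circle of radius `ρ`. -/
theorem integral_circleMap_inv_pow_mul {G : ℂ → ℂ} (hG : DifferentiableOn ℂ G (ball 0 1)) {ρ : ℝ}
    (hρ : 0 < ρ) (hρ1 : ρ < 1) (k : ℕ) :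
    ∫ θ in Set.Ioo (-Real.pi) Real.pi, (circleMap 0 ρ θ)⁻¹ ^ k * G (circleMap 0 ρ θ) =
      2 * Real.pi * ((k.factorial : ℂ)⁻¹ * iteratedDeriv k G 0) := by
  lift ρ to NNReal using hρ.le
  have hd : DifferentiableOn ℂ G (closedBall 0 ρ) := hG.mono (closedBall_subset_ball hρ1)
  have h1 := (hd.hasFPowerSeriesOnBall (by exact_mod_cast hρ)).hasFPowerSeriesAt
  have h2 : AnalyticAt ℂ G 0 := h1.analyticAt
  have h3 := h1.eq_formalMultilinearSeries h2.hasFPowerSeriesAt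
  -- Uniqueness of power series: the Cauchy series and the Taylor series are compared in degree `k`.
  have h4 := congrArg (fun p => (p k) fun _ => (1 : ℂ)) h3
  simp only [cauchyPowerSeries_apply, FormalMultilinearSeries.ofScalars_apply_eq,
    sub_zero, one_pow, smul_eq_mul, mul_one] at h4
  have h5 : ∮ z in C(0, ρ), (1 / z) ^ k * (z⁻¹ * G z)
      = Complex.I * ∫ θ in Set.Ioo (-Real.pi) Real.pi,
        (circleMap 0 ρ θ)⁻¹ ^ k * G (circleMap 0 ρ θ) := by
    have hp : Function.Periodic
        (fun θ => (circleMap 0 ρ θ)⁻¹ ^ k * G (circleMap 0 ρ θ)) (2 * Real.pi) := fun θ => by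
      simp only [periodic_circleMap 0 ρ θ]
    have h6 := hp.intervalIntegral_add_eq 0 (-Real.pi)
    rw [zero_add, show -Real.pi + 2 * Real.pi = Real.pi by ring,
      intervalIntegral.integral_of_le (a := -Real.pi) (by linarith [Real.pi_pos]),
      integral_Ioc_eq_integral_Ioo] at h6
    rw [← h6, circleIntegral, ← intervalIntegral.integral_const_mul]
    refine intervalIntegral.integral_congr fun θ _ => ?_
    have h7 : circleMap 0 ρ θ ≠ 0 := circleMap_ne_center (by exact_mod_cast hρ.ne')
    simp only [deriv_circleMap, smul_eq_mul, one_div]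
    field_simp
  rw [h5] at h4
  have h8 : (2 * Real.pi * Complex.I : ℂ) ≠ 0 := Complex.two_pi_I_ne_zero
  rw [inv_mul_eq_iff_eq_mul₀ h8] at h4
  have h9 : Complex.I ≠ 0 := Complex.I_ne_zero
  apply mul_left_cancel₀ h9
  rw [h4]
  ring

/-- Integration over the disk in polar coordinates. -/
theorem integral_diskMeasure_eq_polar {F : ℂ → ℂ} (hF : ContinuousOn F (ball 0 1))
    (hFi : Integrable F diskMeasure) :
    ∫ z, F z ∂diskMeasure = (Real.pi : ℂ)⁻¹ * ∫ ρ in Set.Ioo (0 : ℝ) 1,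
      (ρ : ℂ) * ∫ θ in Set.Ioo (-Real.pi) Real.pi, F (circleMap 0 ρ θ) := by
  classical
  set g : ℂ → ℂ := (ball (0 : ℂ) 1).indicator F with hg
  have hgm : Measurable g := by
    rw [hg, ← Set.piecewise_eq_indicator]
    exact hF.measurable_piecewise continuousOn_const measurableSet_ball
  have hgi : Integrable g := by
    rw [hg, integrable_indicator_iff measurableSet_ball]
    rw [diskMeasure_eq_smul] at hFi
    exact (integrable_smul_measure (by simp [Real.pi_pos]) (by simp)).1 hFi
  have hsymm : ∀ p : ℝ × ℝ, Complex.polarCoord.symm p = circleMap 0 p.1 p.2 := fun p => by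
    simp [circleMap, Complex.polarCoord_symm_apply, Complex.exp_mul_I]
  have hpm : Measurable fun p : ℝ × ℝ => circleMap 0 p.1 p.2 := by
    simp only [circleMap]; fun_prop
  have hint : IntegrableOn (fun p : ℝ × ℝ => p.1 • g (circleMap 0 p.1 p.2))
      (Set.Ioi 0 ×ˢ Set.Ioo (-Real.pi) Real.pi) (volume.prod volume) := by
    refine ⟨(measurable_fst.smul (hgm.comp hpm)).aestronglyMeasurable, ?_⟩
    have h1 := Complex.lintegral_comp_polarCoord_symm (fun z => ‖g z‖ₑ)
    have h2 : ∫⁻ z, ‖g z‖ₑ < ∞ := hgi.2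
    rw [← h1, polarCoord_target, Measure.volume_eq_prod] at h2
    refine lt_of_eq_of_lt (setLIntegral_congr_fun ?_ ?_) h2
    · exact measurableSet_Ioi.prod measurableSet_Ioo
    · rintro p ⟨hp, -⟩
      have hp0 : (0 : ℝ) < p.1 := hp
      simp only [hsymm, enorm_smul, smul_eq_mul, Real.enorm_eq_ofReal hp0.le]
  have h1 : ∫ z, F z ∂diskMeasure = (Real.pi : ℂ)⁻¹ * ∫ z, g z := by
    rw [diskMeasure_eq_smul, integral_smul_measure, ENNReal.toReal_ofReal (by positivity), hg,
      integral_indicator measurableSet_ball, Complex.real_smul]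
    push_cast
    rfl
  rw [h1, ← Complex.integral_comp_polarCoord_symm, polarCoord_target, Measure.volume_eq_prod]
  simp only [hsymm]
  rw [setIntegral_prod _ hint]
  congr 1
  have hmem : ∀ ρ : ℝ, 0 < ρ → ∀ θ, circleMap 0 ρ θ ∈ ball (0 : ℂ) 1 ↔ ρ < 1 := fun ρ hρ θ => by
    simp [abs_of_pos hρ]
  rw [setIntegral_eq_of_subset_of_forall_sdiff_eq_zero measurableSet_Ioi
    (Set.Ioo_subset_Ioi_self : Set.Ioo (0 : ℝ) 1 ⊆ _)]
  · refine setIntegral_congr_fun measurableSet_Ioo fun ρ hρ => ?_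
    simp only [Complex.real_smul]
    rw [integral_const_mul]
    simp only [hg, Set.indicator_of_mem ((hmem ρ hρ.1 _).2 hρ.2)]
  · rintro ρ ⟨hρ, hρ1⟩
    have hρ0 : 0 < ρ := hρ
    have : ¬ ρ < 1 := fun h => hρ1 ⟨hρ, h⟩
    simp [hg, Set.indicator_of_notMem (fun h => this ((hmem ρ hρ0 _).1 h))]

/-- On the circle of radius ρ the conjugate of `z` is ρ²/z, so the angular integral is Cauchy's
formula times ρ^(2(N+k)). The radial integral then supplies the denominator. -/
theorem integral_conj_pow_mul {G : ℂ → ℂ} (hG : DifferentiableOn ℂ G (ball 0 1))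
    (hGi : Integrable G diskMeasure) (N k : ℕ) :
    ∫ z, (starRingEnd ℂ) (z ^ (N + k)) * (z ^ N * G z) ∂diskMeasure =
      ((k.factorial : ℂ)⁻¹ * iteratedDeriv k G 0) / (N + k + 1) := by
  have hb : ContinuousOn (fun z : ℂ => (starRingEnd ℂ) (z ^ (N + k)) * (z ^ N * G z)) (ball 0 1) := by
    have := hG.continuousOn
    fun_prop
  have hi : Integrable (fun z : ℂ => (starRingEnd ℂ) (z ^ (N + k)) * (z ^ N * G z)) diskMeasure := by
    refine hGi.mono hb.aestronglyMeasurable_diskMeasure ?_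
    filter_upwards [ae_diskMeasure_mem_ball] with z hz
    rw [mem_ball_zero_iff] at hz
    rw [norm_mul, norm_mul, RCLike.norm_conj, norm_pow, norm_pow, ← mul_assoc]
    refine mul_le_of_le_one_left (norm_nonneg _) ?_
    exact mul_le_one₀ (pow_le_one₀ (norm_nonneg _) hz.le) (by positivity)
      (pow_le_one₀ (norm_nonneg _) hz.le)
  rw [integral_diskMeasure_eq_polar hb hi]
  set c := (k.factorial : ℂ)⁻¹ * iteratedDeriv k G 0 with hc
  have h1 : ∀ ρ ∈ Set.Ioo (0 : ℝ) 1, (ρ : ℂ) * ∫ θ in Set.Ioo (-Real.pi) Real.pi,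
      (starRingEnd ℂ) (circleMap 0 ρ θ ^ (N + k)) * (circleMap 0 ρ θ ^ N * G (circleMap 0 ρ θ))
      = ((ρ ^ (2 * (N + k) + 1) : ℝ) : ℂ) * (2 * Real.pi * c) := by
    rintro ρ ⟨hρ, hρ1⟩
    rw [hc, ← integral_circleMap_inv_pow_mul hG hρ hρ1 k, ← integral_const_mul,
      ← integral_const_mul]
    congr 1
    ext θ
    have h7 : circleMap 0 ρ θ ≠ 0 := circleMap_ne_center hρ.ne'
    have h8 : (starRingEnd ℂ) (circleMap 0 ρ θ) = ρ ^ 2 * (circleMap 0 ρ θ)⁻¹ := by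
      rw [eq_mul_inv_iff_mul_eq₀ h7, mul_comm, Complex.mul_conj, Complex.normSq_eq_norm_sq]
      simp
    have h9 : circleMap 0 ρ θ ^ N * (circleMap 0 ρ θ)⁻¹ ^ N = 1 := by
      rw [← mul_pow, mul_inv_cancel₀ h7, one_pow]
    rw [map_pow, h8]
    push_cast
    linear_combination (ρ ^ (2 * (N + k) + 1) * (circleMap 0 ρ θ)⁻¹ ^ k * G (circleMap 0 ρ θ)) * h9
  rw [setIntegral_congr_fun measurableSet_Ioo h1, integral_mul_const, integral_complex_ofReal,
    ← integral_Ioc_eq_integral_Ioo, ← intervalIntegral.integral_of_le zero_le_one, integral_pow]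
  have : (Real.pi : ℂ) ≠ 0 := by exact_mod_cast Real.pi_ne_zero
  have h9 : (N + k + 1 : ℂ) ≠ 0 := by exact_mod_cast (N + k).succ_ne_zero
  push_cast
  simp only [one_pow, ne_eq, Nat.add_eq_zero_iff, one_ne_zero, and_false, not_false_eq_true, zero_pow, sub_zero]
  rw [show (2 * ((N : ℂ) + k) + 1 + 1) = 2 * (N + k + 1) by ring]
  field_simp

/-! ### Compact operators commuting with z^m. -/

/-- A compact operator maps an orthonormal sequence to a null sequence. -/
theorem IsCompactOperator.tendsto_orthonormal {E : Type*} [NormedAddCommGroup E]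
    [InnerProductSpace ℂ E] [CompleteSpace E] {S : E →L[ℂ] E} (hS : IsCompactOperator S)
    {e : ℕ → E} (he : Orthonormal ℂ e) :
    Filter.Tendsto (fun n => S (e n)) Filter.atTop (nhds 0) := by
  refine Filter.tendsto_of_subseq_tendsto fun ns hns => ?_
  obtain ⟨K, hK, hSK⟩ := IsCompactOperator.image_closedBall_subset_compact (𝕜₁ := ℂ)
    (f := (S : E →ₗ[ℂ] E)) hS 1
  obtain ⟨y, -, ms, hms, hy⟩ := hK.tendsto_subseq (x := fun n => S (e (ns n)))
    fun n => hSK ⟨e (ns n), by simp [he.1], rfl⟩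
  -- By Bessel, ⟨e n, S* y⟩ tends to 0. Along the subsequence ⟨S e, y⟩ tends to ⟨y, y⟩ as well, so y
  -- = 0.
  have h1 : Filter.Tendsto (fun n => inner ℂ (e n) (S.adjoint y)) Filter.atTop (nhds 0) := by
    rw [tendsto_zero_iff_norm_tendsto_zero]
    have := (he.inner_products_summable (S.adjoint y)).tendsto_atTop_zero.sqrt
    simpa [Real.sqrt_sq] using this
  have h2 : Filter.Tendsto (fun n => inner ℂ (S (e (ns (ms n)))) y) Filter.atTop (nhds 0) := by
    refine ((h1.comp hns).comp hms.tendsto_atTop).congr fun n => ?_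
    simp only [Function.comp_apply, ContinuousLinearMap.adjoint_inner_right]
  have h3 := tendsto_nhds_unique (hy.inner tendsto_const_nhds) h2
  rw [inner_self_eq_zero] at h3
  exact ⟨ms, by rw [h3] at hy; exact hy⟩

namespace bergmanSpace

theorem inner_eq_integral {f g : bergmanSpace} {F G : ℂ → ℂ} (hF : Set.EqOn (rep f) F (ball 0 1))
    (hG : Set.EqOn (rep g) G (ball 0 1)) :
    inner ℂ f g = ∫ z, (starRingEnd ℂ) (F z) * G z ∂diskMeasure := by
  rw [Submodule.coe_inner, L2.inner_def]
  refine integral_congr_ae ?_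
  filter_upwards [coeFn_ae_eq_rep f, coeFn_ae_eq_rep g, ae_diskMeasure_mem_ball] with z h1 h2 hz
  rw [h1, h2, hF hz, hG hz, RCLike.inner_apply, mul_comm]

/-- The monomial `z ^ n` as an element of the Bergman space. -/
noncomputable def monomial (n : ℕ) : bergmanSpace := (exists_eqOn_rep_pow n).choose

theorem eqOn_rep_monomial (n : ℕ) : Set.EqOn (rep (monomial n)) (fun z => z ^ n) (ball 0 1) :=
  (exists_eqOn_rep_pow n).choose_spec

/-- The Taylor coefficients at the origin of an element of the Bergman space. -/
noncomputable def taylorCoeff (f : bergmanSpace) (k : ℕ) : ℂ :=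
  (k.factorial : ℂ)⁻¹ * iteratedDeriv k (rep f) 0

theorem eq_zero_of_taylorCoeff {f : bergmanSpace} (h : ∀ k, taylorCoeff f k = 0) : f = 0 := by
  refine ext_rep fun z hz => ?_
  rw [eqOn_rep_zero hz, ← Complex.taylorSeries_eq_on_ball' hz (differentiableOn_rep f)]
  have h' : ∀ k : ℕ, (k.factorial : ℂ)⁻¹ * iteratedDeriv k (rep f) 0 = 0 := h
  simp [h']

theorem taylorCoeff_monomial (n k : ℕ) : taylorCoeff (monomial n) k = if k = n then 1 else 0 := by
  have h1 : rep (monomial n) =ᶠ[nhds 0] fun z => z ^ n :=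
    Filter.eventuallyEq_of_mem (ball_mem_nhds 0 one_pos) (eqOn_rep_monomial n)
  rw [taylorCoeff, h1.iteratedDeriv_eq, iteratedDeriv_fun_pow_zero]
  split_ifs with h
  · rw [h, inv_mul_cancel₀ (by exact_mod_cast n.factorial_ne_zero)]
  · simp

theorem inner_monomial_add {f g : bergmanSpace} {N : ℕ}
    (hfg : Set.EqOn (rep g) (fun z => z ^ N * rep f z) (ball 0 1)) (k : ℕ) :
    inner ℂ (monomial (N + k)) g = taylorCoeff f k / (N + k + 1) := by
  rw [inner_eq_integral (eqOn_rep_monomial (N + k)) hfg]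
  exact integral_conj_pow_mul (differentiableOn_rep f) ((memLp_rep f).integrable one_le_two) N k

theorem inner_monomial (f : bergmanSpace) (k : ℕ) :
    inner ℂ (monomial k) f = taylorCoeff f k / (k + 1) := by
  have := inner_monomial_add (f := f) (g := f) (N := 0) (fun z _ => by simp) k
  simpa using this

/-- The normalized monomials. -/
noncomputable def unitMonomial (n : ℕ) : bergmanSpace := ((√(n + 1) : ℝ) : ℂ) • monomial n

theorem inner_smul_smul (a b : ℂ) (f g : bergmanSpace) :
    inner ℂ (a • f) (b • g) = (starRingEnd ℂ) a * (b * inner ℂ f g) := by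
  rw [Submodule.coe_inner, Submodule.coe_inner, Submodule.coe_smul, Submodule.coe_smul,
    inner_smul_left, inner_smul_right]

theorem orthonormal_unitMonomial : Orthonormal ℂ unitMonomial := by
  rw [orthonormal_iff_ite]
  intro i j
  rw [unitMonomial, unitMonomial, inner_smul_smul, inner_monomial,
    taylorCoeff_monomial, Complex.conj_ofReal]
  split_ifs with h
  · subst h
    have h1 : ((√(i + 1) : ℝ) : ℂ) * (√(i + 1) : ℝ) = i + 1 := by
      rw [← Complex.ofReal_mul, Real.mul_self_sqrt (by positivity)]
      push_cast
      rfl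
    have h2 : (i + 1 : ℂ) ≠ 0 := by exact_mod_cast i.succ_ne_zero
    rw [← mul_assoc, h1]
    field_simp
  · simp

theorem toeplitz_X_pow_apply_eq {N : ℕ} {f g : bergmanSpace}
    (h : Set.EqOn (rep g) (fun z => z ^ N * rep f z) (ball 0 1)) :
    toeplitz (polySymbol (X ^ N)) f = g := by
  refine ext_rep fun z hz => ?_
  rw [eqOn_rep_toeplitz _ _ hz, h hz]
  simp

theorem eqOn_rep_toeplitz_X_pow (N : ℕ) (f : bergmanSpace) :
    Set.EqOn (rep (toeplitz (polySymbol (X ^ N)) f)) (fun z => z ^ N * rep f z) (ball 0 1) :=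
  fun z hz => by
    rw [eqOn_rep_toeplitz _ _ hz]
    simp

theorem commute_toeplitz_X_pow_mul {m : ℕ} {S : bergmanSpace →L[ℂ] bergmanSpace}
    (hS : S ∘L toeplitz (polySymbol (X ^ m)) = toeplitz (polySymbol (X ^ m)) ∘L S) (n : ℕ)
    (f : bergmanSpace) :
    S (toeplitz (polySymbol (X ^ (m * n))) f) = toeplitz (polySymbol (X ^ (m * n))) (S f) := by
  have hadd : ∀ (a b : ℕ) (g : bergmanSpace), toeplitz (polySymbol (X ^ (a + b))) g
      = toeplitz (polySymbol (X ^ a)) (toeplitz (polySymbol (X ^ b)) g) := by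
    intro a b g
    refine toeplitz_X_pow_apply_eq fun z hz => ?_
    rw [eqOn_rep_toeplitz_X_pow _ _ hz]
    simp only
    rw [eqOn_rep_toeplitz_X_pow _ _ hz]
    ring
  have h0 : ∀ g, toeplitz (polySymbol (X ^ 0)) g = g := fun g =>
    toeplitz_X_pow_apply_eq fun z _ => by simp
  induction n with
  | zero => rw [mul_zero, h0, h0]
  | succ n ih =>
    rw [mul_add_one, add_comm, hadd, hadd, ← ih]
    exact DFunLike.congr_fun hS _

/-- Totality of the monomials, used through the adjoint: each value of `S.adjoint` is orthogonal to
all monomials, so its Taylor coefficients vanish. -/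
theorem eq_zero_of_forall_monomial {S : bergmanSpace →L[ℂ] bergmanSpace}
    (h : ∀ j, S (monomial j) = 0) : S = 0 := by
  have h1 : S.adjoint = 0 := by
    refine ContinuousLinearMap.ext fun y => eq_zero_of_taylorCoeff fun k => ?_
    have h2 : inner ℂ (monomial k) (S.adjoint y) = 0 := by
      rw [ContinuousLinearMap.adjoint_inner_right, h, inner_zero_left]
    rw [inner_monomial, div_eq_zero_iff] at h2
    exact h2.resolve_right (by exact_mod_cast k.succ_ne_zero)
  refine ContinuousLinearMap.ext fun x => ?_
  rw [← S.adjoint_adjoint, h1]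
  refine ext_inner_left ℂ fun y => ?_
  rw [ContinuousLinearMap.adjoint_inner_right]
  simp

/-- With a_k the k-th Taylor coefficient of S(z^j), the matrix entry of `S` between the normalized
monomials of degrees mn+j and mn+k is a_k √((mn+j+1)/(mn+k+1)). It must tend to 0 as n grows, but
the square root stays away from 0. -/
theorem eq_zero_of_isCompactOperator {m : ℕ} (hm : 1 ≤ m) {S : bergmanSpace →L[ℂ] bergmanSpace}
    (hS : S ∘L toeplitz (polySymbol (X ^ m)) = toeplitz (polySymbol (X ^ m)) ∘L S)
    (hc : IsCompactOperator S) : S = 0 := by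
  refine eq_zero_of_forall_monomial fun j => eq_zero_of_taylorCoeff fun k => ?_
  have hshift : ∀ n, S (monomial (m * n + j)) = toeplitz (polySymbol (X ^ (m * n))) (S (monomial j)) := by
    intro n
    rw [← commute_toeplitz_X_pow_mul hS]
    congr 1
    refine (toeplitz_X_pow_apply_eq fun z hz => ?_).symm
    simp only [eqOn_rep_monomial _ hz, pow_add]
  have hlim : Filter.Tendsto (fun n => ‖S (unitMonomial (m * n + j))‖) Filter.atTop (nhds 0) := by
    have h1 : Function.Injective fun n => m * n + j := fun a b hab =>
      Nat.eq_of_mul_eq_mul_left (by omega) (Nat.add_right_cancel hab)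
    simpa using (hc.tendsto_orthonormal (orthonormal_unitMonomial.comp _ h1)).norm
  have hbound : ∀ n, ‖taylorCoeff (S (monomial j)) k‖ / √(k + 1)
      ≤ ‖S (unitMonomial (m * n + j))‖ := by
    intro n
    have h1 : ‖inner ℂ (unitMonomial (m * n + k)) (S (unitMonomial (m * n + j)))‖
        ≤ ‖S (unitMonomial (m * n + j))‖ := by
      simpa [orthonormal_unitMonomial.1] using
        norm_inner_le_norm (𝕜 := ℂ) (unitMonomial (m * n + k)) (S (unitMonomial (m * n + j)))
    refine le_trans ?_ h1
    rw [unitMonomial, unitMonomial, map_smul, hshift, inner_smul_smul,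
      inner_monomial_add (eqOn_rep_toeplitz_X_pow _ _), Complex.conj_ofReal]
    simp only [norm_mul, norm_div, Complex.norm_real, Real.norm_eq_abs, abs_of_nonneg (Real.sqrt_nonneg _)]
    have h2 : ‖((m * n : ℕ) : ℂ) + k + 1‖ = √((m * n + k : ℕ) + 1) * √((m * n + k : ℕ) + 1) := by
      rw [Real.mul_self_sqrt (by positivity)]
      have : ((m * n : ℕ) : ℂ) + k + 1 = ((m * n + k + 1 : ℕ) : ℂ) := by push_cast; ring
      rw [this, Complex.norm_natCast]
      push_cast
      ring
    rw [h2]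
    have hA : 0 < √(((m * n + k : ℕ) : ℝ) + 1) := by positivity
    -- This is what makes 1/√(k+1) a lower bound for the weight, uniformly in `n`.
    have h3 : √(((m * n + k : ℕ) : ℝ) + 1) ≤ √(((m * n + j : ℕ) : ℝ) + 1) * √(k + 1) := by
      rw [← Real.sqrt_mul (by positivity)]
      refine Real.sqrt_le_sqrt ?_
      have : m * n + k + 1 ≤ (m * n + j + 1) * (k + 1) := by nlinarith [Nat.zero_le (m * n * k), Nat.zero_le (j * k)]
      exact_mod_cast this
    set c := ‖taylorCoeff (S (monomial j)) k‖
    rw [div_le_iff₀ (by positivity)]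
    have h4 : √(((m * n + k : ℕ) : ℝ) + 1) * (√(((m * n + j : ℕ) : ℝ) + 1) *
        (c / (√(((m * n + k : ℕ) : ℝ) + 1) * √(((m * n + k : ℕ) : ℝ) + 1)))) * √(k + 1)
        = c * (√(((m * n + j : ℕ) : ℝ) + 1) * √(k + 1) / √(((m * n + k : ℕ) : ℝ) + 1)) := by
      field_simp
    rw [h4]
    exact le_mul_of_one_le_right (norm_nonneg _) ((one_le_div hA).2 h3)
  have h0 := ge_of_tendsto' hlim hbound
  have hk : 0 < √((k : ℝ) + 1) := by positivity
  rw [div_le_iff₀ hk, zero_mul] at h0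
  exact norm_le_zero_iff.1 h0

end bergmanSpace

theorem theorem1 (h : ℂ[X])
    (hh : ∀ (h₁ : ℂ[X]) (l : ℕ), 1 < l → h ≠ h₁.comp (X ^ l))
    (m : ℕ) (hm : 1 ≤ m)
    (S : bergmanSpace →L[ℂ] bergmanSpace)
    (hS : S ∘L toeplitz (polySymbol (h.comp (X ^ m))) =
      toeplitz (polySymbol (h.comp (X ^ m))) ∘L S) :
    S ∘L toeplitz (polySymbol (X ^ m)) = toeplitz (polySymbol (X ^ m)) ∘L S ∧
      (IsCompactOperator S → S = 0) :=
  have hcomm := bergmanSpace.commute_toeplitz_X_pow hh hm hS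
  ⟨hcomm, bergmanSpace.eq_zero_of_isCompactOperator hm hcomm⟩
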